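/- Fix a dimension $d$. A convex area of $\mathbb{R}^d$ is an intersection $\bigcap_{k=1}^{K}\{z\in\mathbb{R}^d \mid \alpha_k\cdot z+\gamma_k\le 0\}$ of finitely many closed semi-spaces. For finite sets $D\subseteq \mathbf{DS}\subset\mathbb{R}^d$, a set $C$ separates $D$ from $\mathbf{DS}-D$ if $D\subseteq C$ and $C\cap(\mathbf{DS}-D)=\emptyset$, and $D$ is convex-area separable in $\mathbf{DS}$ if some convex area separates $D$ from $\mathbf{DS}-D$. Running times are counted on a real RAM (exact real arithmetic and comparisons, integer counters and addresses, unit cost per elementary operation). Let $\mathrm{gslp}$ be any algorithm that, for every finite nonempty $D\subset\mathbb{R}^d$ and every $x\in\mathbb{R}^d\setminus D$, solves the linear program $LP(x,D)$ (find $w\in\mathbb{R}^d$ with $w\cdot(y-x)<0$ for all $y\in D$): it returns $\emptyset$ if there is no such $w$, and such a $w$ otherwise, in at most $c\,|D|$ steps, where $c$ is a constant. The algorithm $\mathrm{cac}(\mathbf{DS},D)$ computes $U=\mathbf{DS}-D$ and starts with $C=\mathbb{R}^d$. For each $x\in U$ it calls $\mathrm{gslp}(x,D)$. If the answer is $\emptyset$,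 it stops and returns $\emptyset$. If the answer is $w$, it takes the hyperplane $\pi(z)=w\cdot(z-x)$ through $x$, shifts it to $\pi'(z)=\pi(z)-\frac12\max_{y\in D}\pi(y)$, which does not vanish at $x$, sets $\pi_c=\pi'$ if $\pi'(x)>0$ and $\pi_c=-\pi'$ otherwise, and replaces $C$ by $C\cap\{z\mid \pi_c(z)\le 0\}$. After the last $x\in U$ it returns $C$. **Lemma.** Let $D\subseteq \mathbf{DS}\subset\mathbb{R}^d$ be finite with $D\neq\emptyset$, $|\mathbf{DS}|=n$ and $|D|=n'$. Then $\mathrm{cac}(\mathbf{DS},D)$ halts, and: (1) if $\mathrm{cac}(\mathbf{DS},D)=\emptyset$, then $D$ is not convex-area separable in $\mathbf{DS}$; (2) if $\mathrm{cac}(\mathbf{DS},D)=C\neq\emptyset$, then $C$ is a convex area that separates $D$ from $\mathbf{DS}-D$; (3) the running time of $\mathrm{cac}(\mathbf{DS},D)$ is $O(nn')$, i.e. at most $K\,n\,n'$ steps for a constant $K$ that depends only on $d$ and $c$. -/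

import Mathlib

/-! ## A real RAM as a small imperative language with a step count

A state holds named arrays of natural numbers and named two-dimensional tables of real numbers.
Natural numbers serve as counters and as (possibly indirect) addresses; real numbers are added,
subtracted, multiplied, divided and compared exactly.  Every elementary operation costs one step. -/

namespace RealRAM

/-- A memory: arrays of naturals named by `V`, tables of reals named by `T`. -/
structure State (V T : Type) where
  nat : V → ℕ → ℕ
  real : T → ℕ → ℕ → ℝ

/-- Expressions for natural numbers. -/
inductive NExpr (V : Type) where
  | lit (c : ℕ) : NExpr V
  | get (v : V) (i : NExpr V) : NExpr V
  | add (e f : NExpr V) : NExpr V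
  | sub (e f : NExpr V) : NExpr V

/-- Expressions for real numbers. -/
inductive RExpr (V T : Type) where
  | lit (c : ℝ) : RExpr V T
  | get (a : T) (i j : NExpr V) : RExpr V T
  | add (e f : RExpr V T) : RExpr V T
  | sub (e f : RExpr V T) : RExpr V T
  | mul (e f : RExpr V T) : RExpr V T
  | div (e f : RExpr V T) : RExpr V T

/-- Tests. -/
inductive Cond (V T : Type) where
  | natLt (e f : NExpr V) : Cond V T
  | realLt (e f : RExpr V T) : Cond V T
  | and (b c : Cond V T) : Cond V T
  | not (b : Cond V T) : Cond V T

/-- Commands. -/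
inductive Cmd (V T : Type) where
  | skip : Cmd V T
  | setNat (v : V) (i e : NExpr V) : Cmd V T
  | setReal (a : T) (i j : NExpr V) (e : RExpr V T) : Cmd V T
  | seq (p q : Cmd V T) : Cmd V T
  | ite (b : Cond V T) (p q : Cmd V T) : Cmd V T
  | loop (b : Cond V T) (p : Cmd V T) : Cmd V T

infixr:60 " ;; " => Cmd.seq

section semantics

variable {V T : Type}

def NExpr.eval (s : State V T) : NExpr V → ℕ
  | .lit c => c
  | .get v i => s.nat v (i.eval s)
  | .add e f => e.eval s + f.eval s
  | .sub e f => e.eval s - f.eval s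

noncomputable def RExpr.eval (s : State V T) : RExpr V T → ℝ
  | .lit c => c
  | .get a i j => s.real a (i.eval s) (j.eval s)
  | .add e f => e.eval s + f.eval s
  | .sub e f => e.eval s - f.eval s
  | .mul e f => e.eval s * f.eval s
  | .div e f => e.eval s / f.eval s

def Cond.eval (s : State V T) : Cond V T → Prop
  | .natLt e f => e.eval s < f.eval s
  | .realLt e f => e.eval s < f.eval s
  | .and b c => b.eval s ∧ c.eval s
  | .not b => ¬ b.eval s

/-- The cost of evaluating an expression or a test: one step for each of its nodes. -/
def NExpr.cost : NExpr V → ℕ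
  | .lit _ => 1
  | .get _ i => i.cost + 1
  | .add e f => e.cost + f.cost + 1
  | .sub e f => e.cost + f.cost + 1

def RExpr.cost : RExpr V T → ℕ
  | .lit _ => 1
  | .get _ i j => i.cost + j.cost + 1
  | .add e f => e.cost + f.cost + 1
  | .sub e f => e.cost + f.cost + 1
  | .mul e f => e.cost + f.cost + 1
  | .div e f => e.cost + f.cost + 1

def Cond.cost : Cond V T → ℕ
  | .natLt e f => e.cost + f.cost + 1
  | .realLt e f => e.cost + f.cost + 1
  | .and b c => b.cost + c.cost + 1
  | .not b => b.cost + 1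

def State.setNat [DecidableEq V] (s : State V T) (v : V) (i x : ℕ) : State V T :=
  { s with nat := Function.update s.nat v (Function.update (s.nat v) i x) }

def State.setReal [DecidableEq T] (s : State V T) (a : T) (i j : ℕ) (x : ℝ) : State V T :=
  { s with
    real := Function.update s.real a
      (Function.update (s.real a) i (Function.update (s.real a i) j x)) }

/-- `Exec p s t s'`: started in memory `s`, the command `p` halts after exactly `t` steps,
leaving the memory `s'`. -/
inductive Exec [DecidableEq V] [DecidableEq T] :
    Cmd V T → State V T → ℕ → State V T → Prop where
  | skip (s : State V T) : Exec .skip s 1 s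
  | setNat (v : V) (i e : NExpr V) (s : State V T) :
      Exec (.setNat v i e) s (i.cost + e.cost + 1) (s.setNat v (i.eval s) (e.eval s))
  | setReal (a : T) (i j : NExpr V) (e : RExpr V T) (s : State V T) :
      Exec (.setReal a i j e) s (i.cost + j.cost + e.cost + 1)
        (s.setReal a (i.eval s) (j.eval s) (e.eval s))
  | seq {p q : Cmd V T} {s₁ s₂ s₃ : State V T} {t u : ℕ} :
      Exec p s₁ t s₂ → Exec q s₂ u s₃ → Exec (.seq p q) s₁ (t + u) s₃
  | ite_true {b : Cond V T} {p q : Cmd V T} {s s' : State V T} {t : ℕ} :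
      b.eval s → Exec p s t s' → Exec (.ite b p q) s (b.cost + t + 1) s'
  | ite_false {b : Cond V T} {p q : Cmd V T} {s s' : State V T} {t : ℕ} :
      ¬ b.eval s → Exec q s t s' → Exec (.ite b p q) s (b.cost + t + 1) s'
  | loop_true {b : Cond V T} {p : Cmd V T} {s₁ s₂ s₃ : State V T} {t u : ℕ} :
      b.eval s₁ → Exec p s₁ t s₂ → Exec (.loop b p) s₂ u s₃ →
      Exec (.loop b p) s₁ (b.cost + t + u + 1) s₃
  | loop_false {b : Cond V T} {p : Cmd V T} {s : State V T} :
      ¬ b.eval s → Exec (.loop b p) s (b.cost + 1) s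

/-- The machine is deterministic: a command has at most one halting run from a given memory. -/
theorem Exec.det [DecidableEq V] [DecidableEq T] {p : Cmd V T} {s s₁ s₂ : State V T} {t₁ t₂ : ℕ}
    (h₁ : Exec p s t₁ s₁) (h₂ : Exec p s t₂ s₂) : t₁ = t₂ ∧ s₁ = s₂ := by
  induction h₁ generalizing t₂ s₂ with
  | skip s => cases h₂; exact ⟨rfl, rfl⟩
  | setNat v i e s => cases h₂; exact ⟨rfl, rfl⟩
  | setReal a i j e s => cases h₂; exact ⟨rfl, rfl⟩
  | seq _ _ ih ih' =>
    cases h₂ with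
    | seq k k' =>
      obtain ⟨rfl, rfl⟩ := ih k
      obtain ⟨rfl, rfl⟩ := ih' k'
      exact ⟨rfl, rfl⟩
  | ite_true hb _ ih =>
    cases h₂ with
    | ite_true _ k => obtain ⟨rfl, rfl⟩ := ih k; exact ⟨rfl, rfl⟩
    | ite_false hb' _ => exact absurd hb hb'
  | ite_false hb _ ih =>
    cases h₂ with
    | ite_true hb' _ => exact absurd hb' hb
    | ite_false _ k => obtain ⟨rfl, rfl⟩ := ih k; exact ⟨rfl, rfl⟩
  | loop_true hb _ _ ih ih' =>
    cases h₂ with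
    | loop_true _ k k' =>
      obtain ⟨rfl, rfl⟩ := ih k
      obtain ⟨rfl, rfl⟩ := ih' k'
      exact ⟨rfl, rfl⟩
    | loop_false hb' => exact absurd hb hb'
  | loop_false hb =>
    cases h₂ with
    | loop_true hb' _ _ => exact absurd hb' hb
    | loop_false _ => exact ⟨rfl, rfl⟩

/-- The point of `ℝ^d` stored in the first `d` cells of row `i` of the table `a`. -/
def State.row (s : State V T) (d : ℕ) (a : T) (i : ℕ) : Fin d → ℝ := fun j => s.real a i j

/-- The first `|S|` rows of the table `a` list the finite set `S ⊆ ℝ^d`, in some order, each point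
once, and the variable `v` holds `|S|`. -/
def State.Stores {d : ℕ} (s : State V T) (v : V) (a : T) (S : Finset (Fin d → ℝ)) : Prop :=
  s.nat v 0 = S.card ∧ ∀ z : Fin d → ℝ, z ∈ S ↔ ∃ i < S.card, s.row d a i = z

end semantics

/-! Renaming of the variables of a program. -/

section relabel

variable {V T V' T' : Type} (f : V → V') (g : T → T')

def NExpr.map : NExpr V → NExpr V'
  | .lit c => .lit c
  | .get v i => .get (f v) i.map
  | .add e e' => .add e.map e'.map
  | .sub e e' => .sub e.map e'.map

def RExpr.map : RExpr V T → RExpr V' T'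
  | .lit c => .lit c
  | .get a i j => .get (g a) (i.map f) (j.map f)
  | .add e e' => .add e.map e'.map
  | .sub e e' => .sub e.map e'.map
  | .mul e e' => .mul e.map e'.map
  | .div e e' => .div e.map e'.map

def Cond.map : Cond V T → Cond V' T'
  | .natLt e e' => .natLt (e.map f) (e'.map f)
  | .realLt e e' => .realLt (e.map f g) (e'.map f g)
  | .and b c => .and b.map c.map
  | .not b => .not b.map

def Cmd.map : Cmd V T → Cmd V' T'
  | .skip => .skip
  | .setNat v i e => .setNat (f v) (i.map f) (e.map f)
  | .setReal a i j e => .setReal (g a) (i.map f) (j.map f) (e.map f g)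
  | .seq p q => .seq p.map q.map
  | .ite b p q => .ite (b.map f g) p.map q.map
  | .loop b p => .loop (b.map f g) p.map

end relabel

end RealRAM

/-! ## Convex areas and separation -/

namespace ConvexArea

/-- A convex area of `ℝ^d`: an intersection of finitely many closed semi-spaces
`{z | α_k · z + γ_k ≤ 0}`. -/
def IsConvexArea {d : ℕ} (C : Set (Fin d → ℝ)) : Prop :=
  ∃ (K : ℕ) (α : Fin K → Fin d → ℝ) (γ : Fin K → ℝ), C = ⋂ k, {z | α k ⬝ᵥ z + γ k ≤ 0}

/-- `C` separates `D` from `DS - D`. -/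
def Separates {d : ℕ} (C : Set (Fin d → ℝ)) (DS D : Finset (Fin d → ℝ)) : Prop :=
  (D : Set (Fin d → ℝ)) ⊆ C ∧ C ∩ ((DS : Set (Fin d → ℝ)) \ (D : Set (Fin d → ℝ))) = ∅

/-- `D` is convex-area separable in `DS`. -/
def Separable {d : ℕ} (DS D : Finset (Fin d → ℝ)) : Prop :=
  ∃ C : Set (Fin d → ℝ), IsConvexArea C ∧ Separates C DS D

/-- The constraints of the linear program `LP(x, D)`: `w · (y - x) < 0` for all `y ∈ D`. -/
def LPFeasible {d : ℕ} (x : Fin d → ℝ) (D : Finset (Fin d → ℝ)) (w : Fin d → ℝ) : Prop :=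
  ∀ y ∈ D, w ⬝ᵥ (y - x) < 0

/-! ## The sub-algorithm `gslp` -/

open RealRAM

/-- Natural variables of `gslp`: the number of points of `D`, the answer (`0` for `∅`), and
private ones. -/
inductive GVar where
  | size | found | priv (m : ℕ)
  deriving DecidableEq

/-- Real tables of `gslp`: the point `x` (row `0`), the points of `D` (one per row), the computed
`w` (row `0`), and private ones. -/
inductive GTab where
  | x | D | w | priv (m : ℕ)
  deriving DecidableEq

/-- `gslp` solves `LP(x, D)` in dimension `d` in at most `c * |D|` steps, for all finite nonempty
`D` and all `x ∉ D`: it reports `∅` if no `w` is feasible, and delivers a feasible `w` otherwise.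
Nothing is assumed about the other memory cells when it starts. -/
def SolvesLPInLinearTime (d c : ℕ) (gslp : Cmd GVar GTab) : Prop :=
  ∀ (x : Fin d → ℝ) (D : Finset (Fin d → ℝ)), D.Nonempty → x ∉ D →
    ∀ s : State GVar GTab, s.row d .x 0 = x → s.Stores .size .D D →
      ∃ (t : ℕ) (s' : State GVar GTab), Exec gslp s t s' ∧ t ≤ c * D.card ∧
        (s'.nat .found 0 = 0 → ¬ ∃ w, LPFeasible x D w) ∧
        (s'.nat .found 0 ≠ 0 → LPFeasible x D (s'.row d .w 0))

/-! ## The algorithm `cac`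

It uses the variables of `gslp`, through which it passes the arguments and receives the answer, and
a disjoint set of variables of its own. -/

/-- Own natural variables of `cac`: the numbers of points of `DS`, `D`, `U`, the number of
semi-spaces of `C`, three loop counters and three flags. -/
inductive CVar where
  | nDS | nD | nU | nC | k | l | j | eq | mem | ok
  deriving DecidableEq

/-- Own tables of `cac`: the points of `DS`, `D` and `U` (one per row), the semi-spaces of `C`
(row `k` holds `α_k` in columns `0, …, d-1` and `γ_k` in column `d`), and two real variables. -/
inductive CTab where
  | DS | D | U | C | val | max
  deriving DecidableEq

abbrev Var := GVar ⊕ CVar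
abbrev Tab := GTab ⊕ CTab

/-- The value of a variable of `cac`. -/
def var (v : CVar) : NExpr Var := .get (.inr v) (.lit 0)

/-- `v := e`. -/
def assign (v : CVar) (e : NExpr Var) : Cmd Var Tab := .setNat (.inr v) (.lit 0) e

/-- The cell `a[i, j]` of a table of `cac`. -/
def cell (a : CTab) (i j : NExpr Var) : RExpr Var Tab := .get (.inr a) i j

/-- `a[i, j] := e`. -/
def assignCell (a : CTab) (i j : NExpr Var) (e : RExpr Var Tab) : Cmd Var Tab :=
  .setReal (.inr a) i j e

/-- `for v = 0, …, b - 1 do body`. -/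
def forLoop (v : CVar) (b : NExpr Var) (body : Cmd Var Tab) : Cmd Var Tab :=
  assign v (.lit 0) ;;
  .loop (.natLt (var v) b) (body ;; assign v (.add (var v) (.lit 1)))

/-- `U ← DS - D`. -/
def buildU (d : ℕ) : Cmd Var Tab :=
  assign .nU (.lit 0) ;;
  forLoop .k (var .nDS) (
    assign .mem (.lit 0) ;;
    forLoop .l (var .nD) (
      assign .eq (.lit 1) ;;
      forLoop .j (.lit d) (
        .ite (.realLt (cell .DS (var .k) (var .j)) (cell .D (var .l) (var .j)))
          (assign .eq (.lit 0))
          (.ite (.realLt (cell .D (var .l) (var .j)) (cell .DS (var .k) (var .j)))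
            (assign .eq (.lit 0))
            .skip)) ;;
      .ite (.natLt (.lit 0) (var .eq)) (assign .mem (.lit 1)) .skip) ;;
    .ite (.natLt (.lit 0) (var .mem))
      .skip
      (forLoop .j (.lit d)
        (assignCell .U (var .nU) (var .j) (cell .DS (var .k) (var .j))) ;;
       assign .nU (.add (var .nU) (.lit 1))))

/-- Call `gslp(x, D)` for the `k`-th point `x` of `U`. -/
def callGslp (d : ℕ) (gslp : Cmd GVar GTab) : Cmd Var Tab :=
  forLoop .j (.lit d)
    (.setReal (.inl .x) (.lit 0) (var .j) (cell .U (var .k) (var .j))) ;;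
  forLoop .l (var .nD) (
    forLoop .j (.lit d)
      (.setReal (.inl .D) (var .l) (var .j) (cell .D (var .l) (var .j)))) ;;
  .setNat (.inl .size) (.lit 0) (var .nD) ;;
  gslp.map Sum.inl Sum.inl

/-- `val ← π(z)` for `z` in row `i` of the table `a`, where `π` is the affine function stored in
row `nC` of the table `C`. -/
def evalPi (d : ℕ) (a : CTab) (i : NExpr Var) : Cmd Var Tab :=
  assignCell .val (.lit 0) (.lit 0) (cell .C (var .nC) (.lit d)) ;;
  forLoop .j (.lit d)
    (assignCell .val (.lit 0) (.lit 0)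
      (.add (cell .val (.lit 0) (.lit 0))
        (.mul (cell .C (var .nC) (var .j)) (cell a i (var .j)))))

/-- Given the vector `w` found by `gslp(x, D)`, append a semi-space to `C`: start from the
hyperplane `π(z) = w · (z - x)` through `x`, shift it to `π - max_{y ∈ D} π(y) / 2` so that it does
not meet `x`, orient it so that it is positive at `x`, and intersect `C` with `{z | π(z) ≤ 0}`. -/
def addSemispace (d : ℕ) : Cmd Var Tab :=
  assignCell .C (var .nC) (.lit d) (.lit 0) ;;
  forLoop .j (.lit d) (
    assignCell .C (var .nC) (var .j) (.get (.inl .w) (.lit 0) (var .j)) ;;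
    assignCell .C (var .nC) (.lit d)
      (.sub (cell .C (var .nC) (.lit d))
        (.mul (cell .C (var .nC) (var .j)) (cell .U (var .k) (var .j))))) ;;
  forLoop .l (var .nD) (
    evalPi d .D (var .l) ;;
    .ite (.and (.natLt (.lit 0) (var .l))
          (.not (.realLt (cell .max (.lit 0) (.lit 0)) (cell .val (.lit 0) (.lit 0)))))
      .skip
      (assignCell .max (.lit 0) (.lit 0) (cell .val (.lit 0) (.lit 0)))) ;;
  assignCell .C (var .nC) (.lit d)
    (.sub (cell .C (var .nC) (.lit d)) (.div (cell .max (.lit 0) (.lit 0)) (.lit 2))) ;;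
  evalPi d .U (var .k) ;;
  .ite (.realLt (.lit 0) (cell .val (.lit 0) (.lit 0)))
    .skip
    (forLoop .j (.lit (d + 1))
      (assignCell .C (var .nC) (var .j) (.sub (.lit 0) (cell .C (var .nC) (var .j))))) ;;
  assign .nC (.add (var .nC) (.lit 1))

/-- The algorithm `cac(DS, D)` in dimension `d`, with the sub-algorithm `gslp`. -/
def cac (d : ℕ) (gslp : Cmd GVar GTab) : Cmd Var Tab :=
  buildU d ;;
  assign .ok (.lit 1) ;;
  assign .nC (.lit 0) ;;
  assign .k (.lit 0) ;;
  .loop (.and (.natLt (var .k) (var .nU)) (.natLt (.lit 0) (var .ok))) (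
    callGslp d gslp ;;
    .ite (.natLt (.lit 0) (.get (.inl .found) (.lit 0)))
      (addSemispace d ;; assign .k (.add (var .k) (.lit 1)))
      (assign .ok (.lit 0)))

/-- The memory `s` holds the input `(DS, D)` of `cac`; the other cells are arbitrary. -/
def HoldsInput {d : ℕ} (s : State Var Tab) (DS D : Finset (Fin d → ℝ)) : Prop :=
  s.Stores (.inr .nDS) (.inr .DS) DS ∧ s.Stores (.inr .nD) (.inr .D) D

open Classical in
/-- The set returned by `cac`, read off from its final memory: `∅` if the flag `ok` is cleared, and
`⋂ {z | α_k · z + γ_k ≤ 0}` over the stored semi-spaces otherwise. -/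
noncomputable def output (d : ℕ) (s : State Var Tab) : Set (Fin d → ℝ) :=
  if s.nat (.inr .ok) 0 = 0 then ∅
  else ⋂ k : Fin (s.nat (.inr .nC) 0),
    {z | s.row d (.inr .C) k ⬝ᵥ z + s.real (.inr .C) k d ≤ 0}

end ConvexArea

/-!
The program `cac` is verified in a Hoare logic for the real RAM.  The judgement `Run p s N Q` says
that `p`, started in `s`, halts within `N` steps in a memory satisfying `Q`, so halting, correctness
and running time are established together.  The rule of consequence `Run.imp` supplies for free that
arrays and tables which `p` never writes are unchanged (`Frame`); a call of `gslp` inside the larger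
memory of `cac` is reduced to a run of `gslp` alone by `Exec.map_inl`.

The mathematical content is as follows.

* If some convex area separates `D` from `DS - D`, then a point `x` of `DS - D` violates one of its
  constraints `α · z + γ ≤ 0`, which all `y ∈ D` satisfy; hence `α · (y - x) < 0` on `D` and
  `LP(x, D)` is feasible (`Separable.exists_lpFeasible`).  So an infeasible program rules out separability.
* If `w` is feasible for `LP(x, D)` and `π z = w · (z - x)`, then `M = max_{y ∈ D} π y < 0`, so
  `π - M / 2` is at most `M / 2 < 0` on `D` and equals `-M / 2 > 0` at `x`: the appended semi-space
  contains `D` but not `x` (`run_addSemispace`).  It follows that the orientation step of the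
  program never changes the sign.  After all points of `DS - D` have been treated, the intersection of the
  semi-spaces contains `D` and none of these points (`run_mainLoop`, `run_cac`).  It is nonempty
  because `D` is, so the value `∅` is returned only in the infeasible case.
* Building `DS - D` takes `O(d n n')` steps, and each of the at most `n` rounds takes
  `O((c + d) n' + d)` steps, which is `O((c + d) n')` since `n' ≥ 1`.
-/

/-! ### A Hoare logic with step bounds -/

namespace RealRAM

section logic

variable {V T : Type}

/-- `p.WritesNat v`: some assignment occurring in `p` has a cell of the array `v` as its target. -/
def Cmd.WritesNat : Cmd V T → V → Prop
  | .skip, _ => False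
  | .setNat v _ _, u => u = v
  | .setReal _ _ _ _, _ => False
  | .seq p q, u => p.WritesNat u ∨ q.WritesNat u
  | .ite _ p q, u => p.WritesNat u ∨ q.WritesNat u
  | .loop _ p, u => p.WritesNat u

/-- `p.WritesReal a`: some assignment occurring in `p` has a cell of the table `a` as its target. -/
def Cmd.WritesReal : Cmd V T → T → Prop
  | .skip, _ => False
  | .setNat _ _ _, _ => False
  | .setReal a _ _ _, u => u = a
  | .seq p q, u => p.WritesReal u ∨ q.WritesReal u
  | .ite _ p q, u => p.WritesReal u ∨ q.WritesReal u
  | .loop _ p, u => p.WritesReal u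

/-- The memories `s` and `s'` agree on all arrays and tables to which `p` never writes. -/
structure Frame (p : Cmd V T) (s s' : State V T) : Prop where
  nat : ∀ v, ¬ p.WritesNat v → s'.nat v = s.nat v
  real : ∀ a, ¬ p.WritesReal a → s'.real a = s.real a

theorem Frame.refl (p : Cmd V T) (s : State V T) : Frame p s s :=
  ⟨fun _ _ => rfl, fun _ _ => rfl⟩

theorem Frame.trans {p : Cmd V T} {s₁ s₂ s₃ : State V T} (h : Frame p s₁ s₂)
    (h' : Frame p s₂ s₃) : Frame p s₁ s₃ :=
  ⟨fun v hv => (h'.nat v hv).trans (h.nat v hv), fun a ha => (h'.real a ha).trans (h.real a ha)⟩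

theorem Frame.mono {p q : Cmd V T} {s s' : State V T} (h : Frame p s s')
    (hn : ∀ v, p.WritesNat v → q.WritesNat v) (hr : ∀ a, p.WritesReal a → q.WritesReal a) :
    Frame q s s' :=
  ⟨fun v hv => h.nat v fun k => hv (hn v k), fun a ha => h.real a fun k => ha (hr a k)⟩

@[simp] theorem State.setNat_real [DecidableEq V] (s : State V T) (v : V) (i x : ℕ) :
    (s.setNat v i x).real = s.real := rfl

@[simp] theorem State.setNat_nat_self [DecidableEq V] (s : State V T) (v : V) (i x j : ℕ) :
    (s.setNat v i x).nat v j = if j = i then x else s.nat v j := by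
  simp [State.setNat, Function.update_apply]

@[simp] theorem State.setNat_nat_of_ne [DecidableEq V] (s : State V T) {v u : V}
    (i x : ℕ) (h : u ≠ v) :
    (s.setNat v i x).nat u = s.nat u := by
  simp [State.setNat, h]

@[simp] theorem State.setReal_nat [DecidableEq T] (s : State V T) (a : T) (i j : ℕ) (x : ℝ) :
    (s.setReal a i j x).nat = s.nat := rfl

@[simp] theorem State.setReal_real_self [DecidableEq T] (s : State V T) (a : T) (i j : ℕ)
    (x : ℝ) (i' j' : ℕ) :
    (s.setReal a i j x).real a i' j' = if i' = i ∧ j' = j then x else s.real a i' j' := by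
  by_cases hi : i' = i
  · subst hi; simp [State.setReal, Function.update_apply]
  · simp [State.setReal, hi]

@[simp] theorem State.setReal_real_of_ne [DecidableEq T] (s : State V T) {a b : T} (i j : ℕ) (x : ℝ)
    (h : b ≠ a) : (s.setReal a i j x).real b = s.real b := by
  simp [State.setReal, h]

theorem row_congr {V T : Type} {s s' : State V T} {a : T} (h : s'.real a = s.real a) (d i : ℕ) :
    s'.row d a i = s.row d a i :=
  funext fun m => by simp [State.row, h]

@[simp] theorem State.setNat_row {V T : Type} [DecidableEq V] (s : State V T) (v : V)
    (i x d : ℕ) : (s.setNat v i x).row d = s.row d := rfl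

/-- Column `d` lies outside the point stored in a row. -/
@[simp] theorem State.setReal_row {V T : Type} [DecidableEq T] (s : State V T)
    (a : T) (i d : ℕ) (x : ℝ) : (s.setReal a i d x).row d = s.row d := by
  funext b r m
  by_cases hb : b = a
  · subst hb
    simp [State.row, m.2.ne]
  · simp [State.row, hb]

theorem row_eq_iff {V T : Type} {s s' : State V T} {d : ℕ} {a b : T} {i i' : ℕ} :
    s.row d a i = s'.row d b i' ↔ ∀ m < d, s.real a i m = s'.real b i' m :=
  ⟨fun h m hm => congrFun h ⟨m, hm⟩, fun h => funext fun m => h m m.2⟩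

variable [DecidableEq V] [DecidableEq T]

theorem Exec.frame {p : Cmd V T} {s s' : State V T} {t : ℕ} (h : Exec p s t s') :
    Frame p s s' := by
  induction h with
  | skip s => exact .refl _ _
  | setNat v i e s => exact ⟨fun u hu => State.setNat_nat_of_ne s _ _ hu, fun _ _ => rfl⟩
  | setReal a i j e s => exact ⟨fun _ _ => rfl, fun b hb => State.setReal_real_of_ne s _ _ _ hb⟩
  | seq _ _ ih ih' =>
    exact (ih.mono (fun _ => Or.inl) fun _ => Or.inl).trans
      (ih'.mono (fun _ => Or.inr) fun _ => Or.inr)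
  | ite_true _ _ ih => exact ih.mono (fun _ => Or.inl) fun _ => Or.inl
  | ite_false _ _ ih => exact ih.mono (fun _ => Or.inr) fun _ => Or.inr
  | loop_true _ _ _ ih ih' => exact .trans ⟨ih.nat, ih.real⟩ ih'
  | loop_false _ => exact .refl _ _

/-- Total correctness with a step bound: started in `s`, the command `p` halts after at most `N`
steps, in a memory satisfying `Q`. -/
def Run (p : Cmd V T) (s : State V T) (N : ℕ) (Q : State V T → Prop) : Prop :=
  ∃ (t : ℕ) (s' : State V T), Exec p s t s' ∧ t ≤ N ∧ Q s'

/-- The rule of consequence; the new postcondition may use that cells `p` does not write keep their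
contents. -/
theorem Run.imp {p : Cmd V T} {s : State V T} {N N' : ℕ} {Q Q' : State V T → Prop}
    (h : Run p s N Q) (hN : N ≤ N') (hQ : ∀ s', Frame p s s' → Q s' → Q' s') : Run p s N' Q' := by
  obtain ⟨t, s', he, ht, hq⟩ := h
  exact ⟨t, s', he, ht.trans hN, hQ s' he.frame hq⟩

theorem Run.mono {p : Cmd V T} {s : State V T} {N N' : ℕ} {Q : State V T → Prop}
    (h : Run p s N Q) (hN : N ≤ N') : Run p s N' Q :=
  h.imp hN fun _ _ => id

theorem Run.skip {s : State V T} {Q : State V T → Prop} (h : Q s) : Run .skip s 1 Q :=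
  ⟨1, s, .skip s, le_rfl, h⟩

theorem Run.setNat {v : V} {i e : NExpr V} {s : State V T} {Q : State V T → Prop}
    (h : Q (s.setNat v (i.eval s) (e.eval s))) :
    Run (.setNat v i e) s (i.cost + e.cost + 1) Q :=
  ⟨_, _, .setNat v i e s, le_rfl, h⟩

theorem Run.setReal {a : T} {i j : NExpr V} {e : RExpr V T} {s : State V T}
    {Q : State V T → Prop} (h : Q (s.setReal a (i.eval s) (j.eval s) (e.eval s))) :
    Run (.setReal a i j e) s (i.cost + j.cost + e.cost + 1) Q :=
  ⟨_, _, .setReal a i j e s, le_rfl, h⟩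

theorem Run.seq {p q : Cmd V T} {s : State V T} {N M : ℕ} {Q : State V T → Prop}
    (h : Run p s N fun s' => Run q s' M Q) : Run (p ;; q) s (N + M) Q := by
  obtain ⟨t, s', he, ht, t', s'', he', ht', hq⟩ := h
  exact ⟨t + t', s'', .seq he he', add_le_add ht ht', hq⟩

/-- The bounds of both branches are added, which is a cheap bound for their maximum. -/
theorem Run.ite {b : Cond V T} {p q : Cmd V T} {s : State V T} {N M : ℕ} {Q : State V T → Prop}
    (hp : b.eval s → Run p s N Q) (hq : ¬ b.eval s → Run q s M Q) :
    Run (.ite b p q) s (b.cost + (N + M) + 1) Q := by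
  by_cases hb : b.eval s
  · obtain ⟨t, s', he, ht, h⟩ := hp hb
    exact ⟨_, s', .ite_true hb he, by omega, h⟩
  · obtain ⟨t, s', he, ht, h⟩ := hq hb
    exact ⟨_, s', .ite_false hb he, by omega, h⟩

/-- The loop rule: the invariant `I` carries a bound `r` on the number of remaining rounds. -/
theorem Run.loop {b : Cond V T} {p : Cmd V T} {N : ℕ} (I : ℕ → State V T → Prop)
    (hI : ∀ r s, I r s → b.eval s → ∃ r', r = r' + 1 ∧ Run p s N (I r'))
    (r : ℕ) (s : State V T) (h : I r s) :
    Run (.loop b p) s (r * (N + b.cost + 1) + (b.cost + 1))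
      fun s' => ¬ b.eval s' ∧ ∃ r', I r' s' := by
  induction r generalizing s with
  | zero =>
    by_cases hb : b.eval s
    · obtain ⟨r', hr, -⟩ := hI 0 s h hb
      omega
    · exact ⟨_, s, .loop_false hb, by omega, hb, 0, h⟩
  | succ r ih =>
    by_cases hb : b.eval s
    · obtain ⟨r', hr, t, s', he, ht, hI'⟩ := hI _ s h hb
      obtain rfl : r = r' := by omega
      obtain ⟨t', s'', he', ht', hQ⟩ := ih s' hI'
      refine ⟨_, s'', .loop_true hb he he', ?_, hQ⟩
      rw [Nat.succ_mul]
      omega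
    · refine ⟨_, s, .loop_false hb, by omega, hb, _, h⟩

end logic

/-! ### Embedding a program in a larger memory -/

section relabel

variable {V T V' T' : Type}

/-- The part of a memory that consists of the left-hand arrays and tables. -/
def State.left (s : State (V ⊕ V') (T ⊕ T')) : State V T :=
  ⟨fun v => s.nat (.inl v), fun a => s.real (.inl a)⟩

@[simp] theorem NExpr.eval_map_inl (s : State (V ⊕ V') (T ⊕ T')) (e : NExpr V) :
    (e.map Sum.inl).eval s = e.eval s.left := by
  induction e <;> simp_all [NExpr.map, NExpr.eval, State.left]

@[simp] theorem NExpr.cost_map {W : Type} (f : V → W) (e : NExpr V) :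
    (e.map f).cost = e.cost := by
  induction e <;> simp_all [NExpr.map, NExpr.cost]

@[simp] theorem RExpr.eval_map_inl (s : State (V ⊕ V') (T ⊕ T')) (e : RExpr V T) :
    (e.map Sum.inl Sum.inl).eval s = e.eval s.left := by
  induction e <;> simp_all [RExpr.map, RExpr.eval]
  rfl

@[simp] theorem RExpr.cost_map {W U : Type} (f : V → W) (g : T → U) (e : RExpr V T) :
    (e.map f g).cost = e.cost := by
  induction e <;> simp_all [RExpr.map, RExpr.cost]

@[simp] theorem Cond.eval_map_inl (s : State (V ⊕ V') (T ⊕ T')) (b : Cond V T) :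
    (b.map Sum.inl Sum.inl).eval s ↔ b.eval s.left := by
  induction b <;> simp_all [Cond.map, Cond.eval]

@[simp] theorem Cond.cost_map {W U : Type} (f : V → W) (g : T → U) (b : Cond V T) :
    (b.map f g).cost = b.cost := by
  induction b <;> simp_all [Cond.map, Cond.cost]

@[simp] theorem Cmd.not_writesNat_map_inl (p : Cmd V T) (v : V') :
    ¬ (p.map (Sum.inl : V → V ⊕ V') (Sum.inl : T → T ⊕ T')).WritesNat (.inr v) := by
  induction p <;> simp_all [Cmd.map, Cmd.WritesNat]

@[simp] theorem Cmd.not_writesReal_map_inl (p : Cmd V T) (a : T') :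
    ¬ (p.map (Sum.inl : V → V ⊕ V') (Sum.inl : T → T ⊕ T')).WritesReal (.inr a) := by
  induction p <;> simp_all [Cmd.map, Cmd.WritesReal]

variable [DecidableEq V] [DecidableEq T] [DecidableEq V'] [DecidableEq T']

/-- A program whose variables are embedded in a larger memory runs there as it does alone. -/
theorem Exec.map_inl {p : Cmd V T} {s s' : State V T} {t : ℕ} (h : Exec p s t s') :
    ∀ S : State (V ⊕ V') (T ⊕ T'), S.left = s →
      ∃ S', Exec (p.map Sum.inl Sum.inl) S t S' ∧ S'.left = s' := by
  induction h with
  | skip s => exact fun S hS => ⟨S, .skip S, hS⟩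
  | setNat v i e s =>
    rintro S rfl
    have h := Exec.setNat (T := T ⊕ T') (.inl v) (i.map (Sum.inl : V → V ⊕ V')) (e.map Sum.inl) S
    refine ⟨_, by simpa [Cmd.map] using h, ?_⟩
    simp only [State.left, State.setNat, State.mk.injEq, and_true]
    funext u
    by_cases hu : u = v
    · subst hu; simp
    · simp [hu]
  | setReal a i j e s =>
    rintro S rfl
    have h := Exec.setReal (.inl a) (i.map (Sum.inl : V → V ⊕ V')) (j.map Sum.inl)
      (e.map Sum.inl (Sum.inl : T → T ⊕ T')) S
    refine ⟨_, by simpa [Cmd.map] using h, ?_⟩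
    simp only [State.left, State.setReal, State.mk.injEq, true_and]
    funext u
    by_cases hu : u = a
    · subst hu; simp
    · simp [hu]
  | seq _ _ ih ih' =>
    intro S hS
    obtain ⟨S₁, h₁, k₁⟩ := ih S hS
    obtain ⟨S₂, h₂, k₂⟩ := ih' S₁ k₁
    exact ⟨S₂, .seq h₁ h₂, k₂⟩
  | @ite_true b _ _ _ _ _ hb _ ih =>
    rintro S rfl
    obtain ⟨S₁, h₁, k₁⟩ := ih S rfl
    refine ⟨S₁, ?_, k₁⟩
    rw [← Cond.cost_map (W := V ⊕ V') (U := T ⊕ T') Sum.inl Sum.inl b]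
    exact .ite_true (by simpa using hb) h₁
  | @ite_false b _ _ _ _ _ hb _ ih =>
    rintro S rfl
    obtain ⟨S₁, h₁, k₁⟩ := ih S rfl
    refine ⟨S₁, ?_, k₁⟩
    rw [← Cond.cost_map (W := V ⊕ V') (U := T ⊕ T') Sum.inl Sum.inl b]
    exact .ite_false (by simpa using hb) h₁
  | @loop_true b _ _ _ _ _ _ hb _ _ ih ih' =>
    rintro S rfl
    obtain ⟨S₁, h₁, k₁⟩ := ih S rfl
    obtain ⟨S₂, h₂, k₂⟩ := ih' S₁ k₁
    refine ⟨S₂, ?_, k₂⟩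
    rw [← Cond.cost_map (W := V ⊕ V') (U := T ⊕ T') Sum.inl Sum.inl b]
    exact .loop_true (by simpa using hb) h₁ h₂
  | @loop_false b _ _ hb =>
    rintro S rfl
    refine ⟨S, ?_, rfl⟩
    rw [← Cond.cost_map (W := V ⊕ V') (U := T ⊕ T') Sum.inl Sum.inl b]
    exact .loop_false (by simpa using hb)

end relabel

end RealRAM

/-! ### The building blocks of `cac` -/

namespace ConvexArea

open RealRAM

attribute [simp] Cmd.WritesNat Cmd.WritesReal NExpr.eval RExpr.eval Cond.eval
  NExpr.cost RExpr.cost Cond.cost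

@[simp] theorem eval_var (s : State Var Tab) (v : CVar) : (var v).eval s = s.nat (.inr v) 0 := rfl

@[simp] theorem eval_cell (s : State Var Tab) (a : CTab) (i j : NExpr Var) :
    (cell a i j).eval s = s.real (.inr a) (i.eval s) (j.eval s) := rfl

@[simp] theorem cost_var (v : CVar) : (var v).cost = 2 := rfl

@[simp] theorem cost_cell (a : CTab) (i j : NExpr Var) :
    (cell a i j).cost = i.cost + j.cost + 1 := rfl

@[simp] theorem writesNat_assign (v : CVar) (e : NExpr Var) (u : Var) :
    (assign v e).WritesNat u ↔ u = .inr v := Iff.rfl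

@[simp] theorem writesReal_assign (v : CVar) (e : NExpr Var) (u : Tab) :
    (assign v e).WritesReal u ↔ False := Iff.rfl

@[simp] theorem writesNat_assignCell (a : CTab) (i j : NExpr Var) (e : RExpr Var Tab) (u : Var) :
    (assignCell a i j e).WritesNat u ↔ False := Iff.rfl

@[simp] theorem writesReal_assignCell (a : CTab) (i j : NExpr Var) (e : RExpr Var Tab) (u : Tab) :
    (assignCell a i j e).WritesReal u ↔ u = .inr a := Iff.rfl

@[simp] theorem writesNat_forLoop (v : CVar) (b : NExpr Var) (p : Cmd Var Tab) (u : Var) :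
    (forLoop v b p).WritesNat u ↔ u = .inr v ∨ p.WritesNat u := by
  simp only [forLoop, Cmd.WritesNat, writesNat_assign]
  tauto

@[simp] theorem writesReal_forLoop (v : CVar) (b : NExpr Var) (p : Cmd Var Tab) (u : Tab) :
    (forLoop v b p).WritesReal u ↔ p.WritesReal u := by
  simp [forLoop]

theorem run_assign {v : CVar} {e : NExpr Var} {s : State Var Tab} {Q : State Var Tab → Prop}
    (h : Q (s.setNat (.inr v) 0 (e.eval s))) : Run (assign v e) s (e.cost + 2) Q :=
  (Run.setNat h).mono (by simp only [NExpr.cost]; omega)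

theorem run_assignCell {a : CTab} {i j : NExpr Var} {e : RExpr Var Tab} {s : State Var Tab}
    {Q : State Var Tab → Prop} (h : Q (s.setReal (.inr a) (i.eval s) (j.eval s) (e.eval s))) :
    Run (assignCell a i j e) s (i.cost + j.cost + e.cost + 1) Q :=
  Run.setReal h

/-- The rule for counted loops.  The invariant `I i` is asserted when `i` rounds are completed; it
does not have to mention what the loop never writes. -/
theorem run_forLoop {v : CVar} {b : NExpr Var} {body : Cmd Var Tab} {s : State Var Tab} {N n : ℕ}
    (I : ℕ → State Var Tab → Prop) (hv : ¬ body.WritesNat (.inr v))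
    (hb : ∀ s', Frame (forLoop v b body) s s' → b.eval s' = n)
    (h0 : I 0 (s.setNat (.inr v) 0 0))
    (hstep : ∀ i < n, ∀ s', Frame (forLoop v b body) s s' → s'.nat (.inr v) 0 = i → I i s' →
      Run body s' N fun s'' => I (i + 1) (s''.setNat (.inr v) 0 (i + 1))) :
    Run (forLoop v b body) s (n * (N + b.cost + 10) + b.cost + 7) (I n) := by
  have hw (s' : State Var Tab) (x : ℕ) : Frame (forLoop v b body) s' (s'.setNat (.inr v) 0 x) :=
    ⟨fun u hu => State.setNat_nat_of_ne _ _ _ (by rintro rfl; simp at hu), fun _ _ => rfl⟩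
  have key := Run.loop (b := .natLt (var v) b) (p := body ;; assign v (.add (var v) (.lit 1)))
    (N := N + 6)
    (fun r s' => ∃ i, i + r = n ∧ s'.nat (.inr v) 0 = i ∧ Frame (forLoop v b body) s s' ∧ I i s')
    (by
      rintro r s' ⟨i, hr, hi, hF, hI⟩ hlt
      have hlt' : i < n := by simpa [hi, hb s' hF] using hlt
      obtain ⟨r', rfl⟩ : ∃ r', r = r' + 1 := ⟨r - 1, by omega⟩
      refine ⟨r', rfl, Run.seq ?_⟩
      refine (hstep i hlt' s' hF hi hI).imp le_rfl fun s'' hF' hI' => ?_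
      have hi' : s''.nat (.inr v) 0 = i := by rw [hF'.nat _ hv, hi]
      refine run_assign ⟨i + 1, by omega, by simp [hi'], ?_, by simpa [hi'] using hI'⟩
      refine (hF.trans (hF'.mono ?_ ?_)).trans (hw _ _)
      · exact fun u hu => by simp [hu]
      · exact fun u hu => by simp [hu])
    n (s.setNat (.inr v) 0 0) ⟨0, by omega, by simp, hw _ _, h0⟩
  refine Run.imp (Run.seq (run_assign key)) ?_ ?_
  · simp only [Cond.cost, cost_var, NExpr.cost]
    have : N + 6 + (2 + b.cost + 1) + 1 = N + b.cost + 10 := by ring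
    rw [this]
    omega
  · rintro s' - ⟨hlt, r', i, hr, hi, hF, hI⟩
    have : ¬ i < n := by simpa [hi, hb s' hF] using hlt
    obtain rfl : i = n := by omega
    exact hI

/-- Copying the first `d` cells of row `i'` of the table `b` to row `i` of the table `a`. -/
theorem run_copyRow (d : ℕ) {a b : Tab} {i i' : NExpr Var} (s : State Var Tab) (hab : b ≠ a)
    (hi : ∀ s' : State Var Tab, (∀ v, v ≠ .inr .j → s'.nat v = s.nat v) → i.eval s' = i.eval s)
    (hi' : ∀ s' : State Var Tab, (∀ v, v ≠ .inr .j → s'.nat v = s.nat v) →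
      i'.eval s' = i'.eval s) :
    Run (forLoop .j (.lit d) (.setReal a i (var .j) (.get b i' (var .j)))) s
      (d * (i.cost + i'.cost + 17) + 8)
      fun s' => ∀ r m, s'.real a r m =
        if r = i.eval s ∧ m < d then s.real b (i'.eval s) m else s.real a r m := by
  refine (run_forLoop (n := d) (fun n s' => ∀ r m, s'.real a r m =
    if r = i.eval s ∧ m < n then s.real b (i'.eval s) m else s.real a r m)
    (by simp) (fun s' _ => rfl) (by simp) fun n hn s' hF hj hI => Run.setReal ?_).mono ?_
  · have h1 := hi s' fun v hv => hF.nat v (by simpa using hv)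
    have h2 := hi' s' fun v hv => hF.nat v (by simpa using hv)
    have h3 := hF.real b (by simpa using hab)
    intro r m
    simp only [State.setNat_real, State.setReal_real_self, h1, h2, eval_var, hj, RExpr.eval, h3, hI]
    grind
  · simp only [NExpr.cost, RExpr.cost, cost_var]
    rw [add_assoc]
    exact add_le_add (Nat.mul_le_mul_left _ (by omega)) (by omega)

/-- The loop of `buildU` that compares the `k`-th point of `DS` with the `l`-th point of `D`. -/
def compareLoop (d : ℕ) : Cmd Var Tab :=
  forLoop .j (.lit d) (
    .ite (.realLt (cell .DS (var .k) (var .j)) (cell .D (var .l) (var .j)))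
      (assign .eq (.lit 0))
      (.ite (.realLt (cell .D (var .l) (var .j)) (cell .DS (var .k) (var .j)))
        (assign .eq (.lit 0))
        .skip))

theorem run_compareLoop (d : ℕ) (s : State Var Tab) :
    Run (compareLoop d) s (d * 50 + 8) fun s' => 0 < s'.nat (.inr .eq) 0 ↔
      0 < s.nat (.inr .eq) 0 ∧
        s.row d (.inr .DS) (s.nat (.inr .k) 0) = s.row d (.inr .D) (s.nat (.inr .l) 0) := by
  simp only [row_eq_iff]
  refine (run_forLoop (n := d) (fun n s' => 0 < s'.nat (.inr .eq) 0 ↔ 0 < s.nat (.inr .eq) 0 ∧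
      ∀ m < n, s.real (.inr .DS) (s.nat (.inr .k) 0) m = s.real (.inr .D) (s.nat (.inr .l) 0) m)
    (by simp) (fun s' _ => rfl) (by simp) fun n hn s' hF hj hI =>
      Run.ite (fun hb => run_assign ?_) fun hb => Run.ite (fun hb => run_assign ?_) fun hb' =>
        Run.skip ?_).mono ?_
  all_goals try
    have hk := hF.nat (.inr .k) (by simp)
    have hl := hF.nat (.inr .l) (by simp)
    have hDS := hF.real (.inr .DS) (by simp)
    have hD := hF.real (.inr .D) (by simp)
  · simp [hj, hk, hl, hDS, hD] at hb ⊢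
    exact fun _ => ⟨n, by omega, hb.ne⟩
  · simp [hj, hk, hl, hDS, hD] at hb ⊢
    exact fun _ => ⟨n, by omega, hb.ne'⟩
  · simp [hj, hk, hl, hDS, hD] at hb hb' hI ⊢
    rw [hI]
    refine and_congr_right fun _ => ⟨fun h m hm => ?_, fun h m hm => h m (by omega)⟩
    obtain hm' | rfl := Nat.lt_or_eq_of_le hm
    · exact h m hm'
    · exact le_antisymm hb' hb
  · simp
    omega

/-- The loop of `buildU` that looks for the `k`-th point of `DS` in `D`. -/
def memberLoop (d : ℕ) : Cmd Var Tab :=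
  forLoop .l (var .nD) (
    assign .eq (.lit 1) ;;
    compareLoop d ;;
    .ite (.natLt (.lit 0) (var .eq)) (assign .mem (.lit 1)) .skip)

theorem run_memberLoop (d : ℕ) (s : State Var Tab) :
    Run (memberLoop d) s (s.nat (.inr .nD) 0 * (d * 50 + 40) + 9) fun s' =>
      0 < s'.nat (.inr .mem) 0 ↔ 0 < s.nat (.inr .mem) 0 ∨
        ∃ l < s.nat (.inr .nD) 0,
          s.row d (.inr .D) l = s.row d (.inr .DS) (s.nat (.inr .k) 0) := by
  refine (run_forLoop (n := s.nat (.inr .nD) 0) (fun n s' => 0 < s'.nat (.inr .mem) 0 ↔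
      0 < s.nat (.inr .mem) 0 ∨
        ∃ l < n, s.row d (.inr .D) l = s.row d (.inr .DS) (s.nat (.inr .k) 0))
    (by simp [compareLoop]) (fun s' hF => ?_) (by simp) fun n hn s' hF hl hI =>
      Run.seq (run_assign (Run.seq ((run_compareLoop d _).imp le_rfl fun s'' hF' h' =>
        Run.ite (fun hb => run_assign ?_) fun hb => Run.skip ?_)))).mono ?_
  · rw [eval_var, hF.nat _ (by simp [compareLoop])]
  all_goals try
    have hk := hF.nat (.inr .k) (by simp [compareLoop])
    have hDS := row_congr (hF.real (.inr .DS) (by simp [compareLoop])) d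
    have hD := row_congr (hF.real (.inr .D) (by simp [compareLoop])) d
    have hm := hF'.nat (.inr .mem) (by simp [compareLoop])
    simp [hl, hk, hDS, hD] at h'
  · simp [h'] at hb
    simp
    exact .inr ⟨n, by omega, hb.symm⟩
  · simp [h'] at hb
    simp [hm, hI]
    refine or_congr_right ⟨fun ⟨l, hl, h⟩ => ⟨l, by omega, h⟩, fun ⟨l, hl, h⟩ => ⟨l, ?_, h⟩⟩
    have : l ≠ n := by rintro rfl; exact hb h.symm
    omega
  · simp
    exact Nat.mul_le_mul_left _ (by omega)

theorem buildU_eq (d : ℕ) : buildU d =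
    (assign .nU (.lit 0) ;;
    forLoop .k (var .nDS) (
      assign .mem (.lit 0) ;;
      memberLoop d ;;
      .ite (.natLt (.lit 0) (var .mem))
        .skip
        (forLoop .j (.lit d)
          (assignCell .U (var .nU) (var .j) (cell .DS (var .k) (var .j))) ;;
         assign .nU (.add (var .nU) (.lit 1))))) := rfl

/-- `buildU` lists the points of `DS` that are not in `D`, in at most as many rows as `DS` has. -/
theorem run_buildU (d : ℕ) (s : State Var Tab) :
    Run (buildU d) s
      (s.nat (.inr .nDS) 0 * (s.nat (.inr .nD) 0 * (d * 50 + 40) + (d * 30 + 60)) + 20) fun s' =>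
      s'.nat (.inr .nU) 0 ≤ s.nat (.inr .nDS) 0 ∧
      ∀ z, (∃ i < s'.nat (.inr .nU) 0, s'.row d (.inr .U) i = z) ↔
        (∃ i < s.nat (.inr .nDS) 0, s.row d (.inr .DS) i = z) ∧
          ¬ ∃ l < s.nat (.inr .nD) 0, s.row d (.inr .D) l = z := by
  rw [buildU_eq]
  refine (Run.seq (run_assign (run_forLoop (n := s.nat (.inr .nDS) 0)
    (N := s.nat (.inr .nD) 0 * (d * 50 + 40) + (d * 30 + 48))
    (fun n s' => s'.nat (.inr .nU) 0 ≤ n ∧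
      ∀ z, (∃ i < s'.nat (.inr .nU) 0, s'.row d (.inr .U) i = z) ↔
        (∃ i < n, s.row d (.inr .DS) i = z) ∧
          ¬ ∃ l < s.nat (.inr .nD) 0, s.row d (.inr .D) l = z)
    (by simp [compareLoop, memberLoop]) (fun s' hF => ?_) (by simp) fun n hn s' hF hk hI =>
    Run.mono (Run.seq (run_assign (Run.seq ((run_memberLoop d _).imp le_rfl fun s₁ hF₁ h₁ =>
      Run.ite (fun hb => Run.skip ?_) fun hb => Run.seq ((run_copyRow d (a := .inr .U)
        (b := .inr .DS) (i := var .nU) (i' := var .k) s₁ (by simp)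
        (fun _ h => congrFun (h _ (by simp)) 0) (fun _ h => congrFun (h _ (by simp)) 0)).imp le_rfl
        fun s₂ hF₂ h₂ => run_assign ?_))))) ?_))).mono ?_
  · rw [eval_var, hF.nat _ (by simp [compareLoop, memberLoop])]
    simp
  all_goals try
    have hDS := row_congr (hF.real (.inr .DS) (by simp [compareLoop, memberLoop])) d
    have hD := row_congr (hF.real (.inr .D) (by simp [compareLoop, memberLoop])) d
    have hnD := congrFun (hF.nat (.inr .nD) (by simp [compareLoop, memberLoop])) 0
    have hnU := congrFun (hF₁.nat (.inr .nU) (by simp [compareLoop, memberLoop])) 0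
    have hk₁ := congrFun (hF₁.nat (.inr .k) (by simp [compareLoop, memberLoop])) 0
    have hU := row_congr (hF₁.real (.inr .U) (by simp [compareLoop, memberLoop])) d
    have hDS₁ := row_congr (hF₁.real (.inr .DS) (by simp [compareLoop, memberLoop])) d
    simp [hk, hnD, hDS, hD] at h₁ hb hnU hk₁ hU hDS₁
  · refine ⟨by simp [hnU]; omega, fun z => ?_⟩
    simp only [State.setNat_row, hU, Nat.exists_lt_succ_right]
    simp only [ne_eq, reduceCtorEq, not_false_eq_true, State.setNat_nat_of_ne, Sum.inr.injEq, hnU,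
      hI.2]
    have := h₁.1 hb
    refine and_congr_left fun hz => ⟨.inl, fun h => h.resolve_right ?_⟩
    rintro rfl
    exact hz this
  -- The `k`-th point of `DS` is not in `D`: it becomes the last row of `U`.
  · have h_new : s₂.row d (.inr .U) (s'.nat (.inr .nU) 0) = s.row d (.inr .DS) n := by
      rw [← hDS₁, row_eq_iff]
      intro m hm
      simp [h₂, hnU, hm, hk₁]
    have h_old (i) (hi : i < s'.nat (.inr .nU) 0) :
        s₂.row d (.inr .U) i = s'.row d (.inr .U) i := by
      rw [← hU, row_eq_iff]
      intro m hm
      simp [h₂, hnU, hi.ne]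
    have hnU₂ := congrFun (hF₂.nat (.inr .nU) (by simp)) 0
    refine ⟨by simp [hnU₂, hnU, hI.1], fun z => ?_⟩
    have hn : ¬ ∃ l < s.nat (.inr .nD) 0, s.row d (.inr .D) l = s.row d (.inr .DS) n := by
      rw [← h₁]
      simpa using hb
    have hI' := hI.2 z
    simp only [State.setNat_row, Nat.exists_lt_succ_right]
    simp [hnU₂, hnU, Nat.exists_lt_succ_right, -Order.lt_add_one_iff, h_new, -not_exists]
    rw [exists_congr fun i => and_congr_right fun hi => by rw [h_old i hi], hI', or_and_right]
    refine or_congr_right ⟨?_, And.left⟩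
    rintro rfl
    exact ⟨rfl, hn⟩
  · have hnD := congrFun (hF.nat (.inr .nD) (by simp [compareLoop, memberLoop])) 0
    simp at hnD
    simp [hnD]
    omega
  · simp
    linarith

/-! ### The call of `gslp` -/

/-- `callGslp` answers `LP(x, D)` for the `k`-th point `x` of `U`. -/
theorem run_callGslp {d c : ℕ} {gslp : Cmd GVar GTab} (hg : SolvesLPInLinearTime d c gslp)
    {D : Finset (Fin d → ℝ)} (hD : D.Nonempty) (s : State Var Tab)
    (hs : s.Stores (.inr .nD) (.inr .D) D)
    (hx : s.row d (.inr .U) (s.nat (.inr .k) 0) ∉ D) :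
    Run (callGslp d gslp) s (D.card * (d * 25 + c + 30) + (d * 25 + 40)) fun s' =>
      (s'.nat (.inl .found) 0 = 0 →
        ¬ ∃ w, LPFeasible (s.row d (.inr .U) (s.nat (.inr .k) 0)) D w) ∧
      (s'.nat (.inl .found) 0 ≠ 0 →
        LPFeasible (s.row d (.inr .U) (s.nat (.inr .k) 0)) D (s'.row d (.inl .w) 0)) := by
  obtain ⟨hcard, hrow⟩ := hs
  refine (Run.seq ((run_copyRow d (a := .inl .x) (b := .inr .U) (i := .lit 0) (i' := var .k) s
    (by simp) (fun _ _ => rfl) (fun _ h => congrFun (h _ (by simp)) 0)).imp le_rfl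
    fun s₁ hF₁ h₁ => Run.seq ((run_forLoop (n := D.card) (N := d * 21 + 8)
      (fun n s' => ∀ r < n, s'.row d (.inl .D) r = s.row d (.inr .D) r) (by simp)
      (fun s' hF => ?_) (by simp) fun n hn s' hF hl hI =>
        (run_copyRow d (a := .inl .D) (b := .inr .D) (i := var .l) (i' := var .l) s' (by simp)
          (fun _ h => congrFun (h _ (by simp)) 0)
          (fun _ h => congrFun (h _ (by simp)) 0)).imp le_rfl fun s'' hF' h' => ?_).imp le_rfl
      fun s₂ hF₂ h₂ => Run.seq (Run.setNat (?_ : Run _ _ (c * D.card) _))))).mono ?_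
  · simp [hF.nat, hF₁.nat, hcard]
  · have hD₁ := row_congr (hF₁.real (.inr .D) (by simp)) d
    have hD' := row_congr (hF.real (.inr .D) (by simp)) d
    intro r hr
    rw [State.setNat_row]
    obtain hr' | rfl := Nat.lt_succ_iff_lt_or_eq.1 hr
    · rw [← hI r hr', row_eq_iff]
      intro m hm
      simp [h', hl, hr'.ne]
    · rw [← hD₁, ← hD', row_eq_iff]
      intro m hm
      simp [h', hl, hm]
  · have hnD : s₂.nat (.inr .nD) 0 = D.card := by simp [hF₂.nat, hF₁.nat, hcard]
    set S := s₂.setNat (.inl .size) ((NExpr.lit 0 : NExpr Var).eval s₂) ((var .nD).eval s₂) with hS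
    have hxS : S.left.row d .x 0 = s.row d (.inr .U) (s.nat (.inr .k) 0) := by
      change s₂.row d (.inl .x) 0 = _
      rw [row_congr (hF₂.real (.inl .x) (by simp)), row_eq_iff]
      intro m hm
      simp [h₁, hm]
    have hSt : S.left.Stores .size .D D := by
      refine ⟨by simp [State.left, hS, hnD], fun z => ?_⟩
      rw [hrow]
      refine exists_congr fun i => and_congr_right fun hi => ?_
      change _ ↔ s₂.row d (.inl .D) i = z
      rw [h₂ i hi]
    obtain ⟨t, s', he, ht, h0, h1⟩ := hg _ D hD hx S.left hxS hSt
    obtain ⟨S', he', rfl⟩ := he.map_inl S rfl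
    exact ⟨t, S', he', ht, h0, h1⟩
  · simp
    nlinarith [Nat.zero_le (D.card * d)]

/-! ### Appending a semi-space -/

/-- `evalPi` evaluates the affine function in row `nC` of `C` at the point in row `v` of `a`. -/
theorem run_evalPi (d : ℕ) {a : CTab} {v : CVar} (s : State Var Tab) (ha : a ≠ .val)
    (hv : v ≠ .j) :
    Run (evalPi d a (var v)) s (d * 40 + 20) fun s' => s'.real (.inr .val) 0 0 =
      s.row d (.inr .C) (s.nat (.inr .nC) 0) ⬝ᵥ s.row d (.inr a) (s.nat (.inr v) 0) +
        s.real (.inr .C) (s.nat (.inr .nC) 0) d := by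
  refine (Run.seq (run_assignCell ((run_forLoop (n := d) (fun n s' => s'.real (.inr .val) 0 0 =
      ∑ m ∈ Finset.range n, s.real (.inr .C) (s.nat (.inr .nC) 0) m *
          s.real (.inr a) (s.nat (.inr v) 0) m +
        s.real (.inr .C) (s.nat (.inr .nC) 0) d)
    (by simp) (fun s' _ => rfl) (by simp) fun n hn s' hF hj hI => run_assignCell ?_).imp le_rfl
      fun s' hF h => ?_))).mono ?_
  · have hC := hF.real (.inr .C) (by simp)
    have hA := hF.real (.inr a) (by simpa using ha)
    have hnC := hF.nat (.inr .nC) (by simp)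
    have hv' := hF.nat (.inr v) (by simpa using hv)
    simp [ha] at hC hA hnC hv'
    simp [hC, hA, hnC, hv', hj, hI, Finset.sum_range_succ]
    ring
  · rw [h, dotProduct, ← Fin.sum_univ_eq_sum_range (fun m =>
      s.real (.inr .C) (s.nat (.inr .nC) 0) m * s.real (.inr a) (s.nat (.inr v) 0) m)]
    rfl
  · simp
    linarith

/-- Loading row `nC` of `C` with `z ↦ w · (z - x)`, where `x` is the `k`-th point of `U`. -/
def loadHyperplane (d : ℕ) : Cmd Var Tab :=
  forLoop .j (.lit d) (
    assignCell .C (var .nC) (var .j) (.get (.inl .w) (.lit 0) (var .j)) ;;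
    assignCell .C (var .nC) (.lit d)
      (.sub (cell .C (var .nC) (.lit d))
        (.mul (cell .C (var .nC) (var .j)) (cell .U (var .k) (var .j)))))

theorem run_loadHyperplane (d : ℕ) (s : State Var Tab) :
    Run (loadHyperplane d) s (d * 50 + 10) fun s' =>
      s'.row d (.inr .C) (s.nat (.inr .nC) 0) = s.row d (.inl .w) 0 ∧
      s'.real (.inr .C) (s.nat (.inr .nC) 0) d = s.real (.inr .C) (s.nat (.inr .nC) 0) d -
        s.row d (.inl .w) 0 ⬝ᵥ s.row d (.inr .U) (s.nat (.inr .k) 0) ∧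
      ∀ r ≠ s.nat (.inr .nC) 0, ∀ m, s'.real (.inr .C) r m = s.real (.inr .C) r m := by
  refine (run_forLoop (n := d) (fun n s' =>
      (∀ m < n, s'.real (.inr .C) (s.nat (.inr .nC) 0) m = s.real (.inl .w) 0 m) ∧
      s'.real (.inr .C) (s.nat (.inr .nC) 0) d = s.real (.inr .C) (s.nat (.inr .nC) 0) d -
        ∑ m ∈ Finset.range n, s.real (.inl .w) 0 m * s.real (.inr .U) (s.nat (.inr .k) 0) m ∧
      ∀ r ≠ s.nat (.inr .nC) 0, ∀ m, s'.real (.inr .C) r m = s.real (.inr .C) r m)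
    (by simp) (fun s' _ => rfl) (by simp) fun n hn s' hF hj hI =>
      Run.seq (run_assignCell (run_assignCell ?_))).imp ?_ fun s' hF h => ?_
  · have hw := hF.real (.inl .w) (by simp)
    have hU := hF.real (.inr .U) (by simp)
    have hnC := hF.nat (.inr .nC) (by simp)
    have hk := hF.nat (.inr .k) (by simp)
    obtain ⟨h1, h2, h3⟩ := hI
    simp [hw, hU, hnC, hk, hj, hn.ne']
    refine ⟨fun m hm => ?_, ?_, fun r hr m => ?_⟩
    · rw [if_neg (by omega)]
      obtain hm' | rfl := Nat.lt_or_eq_of_le hm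
      · rw [if_neg hm'.ne, h1 m hm']
      · rw [if_pos rfl]
    · rw [h2, Finset.sum_range_succ]
      ring
    · simp [hr, h3 r hr]
  · simp
    omega
  · obtain ⟨h1, h2, h3⟩ := h
    refine ⟨row_eq_iff.2 h1, ?_, h3⟩
    rw [h2, dotProduct, ← Fin.sum_univ_eq_sum_range (fun m =>
      s.real (.inl .w) 0 m * s.real (.inr .U) (s.nat (.inr .k) 0) m)]
    rfl

/-- The loop that computes the maximum over `D` of the affine function in row `nC` of `C`. -/
def maxLoop (d : ℕ) : Cmd Var Tab :=
  forLoop .l (var .nD) (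
    evalPi d .D (var .l) ;;
    .ite (.and (.natLt (.lit 0) (var .l))
          (.not (.realLt (cell .max (.lit 0) (.lit 0)) (cell .val (.lit 0) (.lit 0)))))
      .skip
      (assignCell .max (.lit 0) (.lit 0) (cell .val (.lit 0) (.lit 0))))

/-- The first clause needs a nonempty `D`: otherwise the cell `max` keeps an arbitrary value. -/
theorem run_maxLoop (d : ℕ) (s : State Var Tab) (π : (Fin d → ℝ) → ℝ)
    (hπ : ∀ z, π z = s.row d (.inr .C) (s.nat (.inr .nC) 0) ⬝ᵥ z +
      s.real (.inr .C) (s.nat (.inr .nC) 0) d) :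
    Run (maxLoop d) s (s.nat (.inr .nD) 0 * (d * 40 + 60) + 10) fun s' =>
      (0 < s.nat (.inr .nD) 0 →
        ∃ l < s.nat (.inr .nD) 0, s'.real (.inr .max) 0 0 = π (s.row d (.inr .D) l)) ∧
      ∀ l < s.nat (.inr .nD) 0, π (s.row d (.inr .D) l) ≤ s'.real (.inr .max) 0 0 := by
  refine (run_forLoop (n := s.nat (.inr .nD) 0) (fun n s' =>
      (0 < n → ∃ l < n, s'.real (.inr .max) 0 0 = π (s.row d (.inr .D) l)) ∧
      ∀ l < n, π (s.row d (.inr .D) l) ≤ s'.real (.inr .max) 0 0)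
    (by simp [evalPi]) (fun s' hF => ?_) (by simp) fun n hn s' hF hl hI =>
      Run.seq ((run_evalPi d s' (by simp) (by simp)).imp le_rfl fun s'' hF' h' =>
        Run.ite (fun hb => Run.skip ?_) fun hb => run_assignCell ?_)).mono ?_
  · simp [hF.nat, evalPi]
  all_goals try
    have hD := row_congr (hF.real (.inr .D) (by simp [evalPi])) d
    have hC := hF.real (.inr .C) (by simp [evalPi])
    have hnC := hF.nat (.inr .nC) (by simp [evalPi])
    have hmax := hF'.real (.inr .max) (by simp [evalPi])
    have hl' := hF'.nat (.inr .l) (by simp [evalPi])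
    rw [hnC, hD, row_congr hC, hC, hl, ← hπ] at h'
    obtain ⟨h1, h2⟩ := hI
    simp only [Cond.eval, NExpr.eval, eval_var, eval_cell, hl', hl, hmax, h', not_lt] at hb
  · simp [hmax]
    refine ⟨?_, fun l hl => ?_⟩
    · obtain ⟨l, hl, h⟩ := h1 hb.1
      exact ⟨l, hl.le, h⟩
    · obtain hl | rfl := Nat.lt_or_eq_of_le hl
      · exact h2 l hl
      · exact hb.2
  · simp [h']
    refine ⟨⟨n, le_rfl, rfl⟩, fun l hl => ?_⟩
    obtain hl | rfl := Nat.lt_or_eq_of_le hl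
    · have := h2 l hl
      have := not_le.1 fun h => hb ⟨by omega, h⟩
      linarith
    · exact le_rfl
  · simp
    linarith

theorem addSemispace_eq (d : ℕ) : addSemispace d =
    (assignCell .C (var .nC) (.lit d) (.lit 0) ;;
    loadHyperplane d ;;
    maxLoop d ;;
    assignCell .C (var .nC) (.lit d)
      (.sub (cell .C (var .nC) (.lit d)) (.div (cell .max (.lit 0) (.lit 0)) (.lit 2))) ;;
    evalPi d .U (var .k) ;;
    .ite (.realLt (.lit 0) (cell .val (.lit 0) (.lit 0)))
      .skip
      (forLoop .j (.lit (d + 1))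
        (assignCell .C (var .nC) (var .j) (.sub (.lit 0) (cell .C (var .nC) (var .j))))) ;;
    assign .nC (.add (var .nC) (.lit 1))) := rfl

/-- If `w` is feasible for `LP(x, D)`, where `x` is the `k`-th point of `U`, then the semi-space
appended by `addSemispace` contains `D` but not `x`. -/
theorem run_addSemispace {d : ℕ} {D : Finset (Fin d → ℝ)} (hD : D.Nonempty) (s : State Var Tab)
    (hs : s.Stores (.inr .nD) (.inr .D) D)
    (hw : LPFeasible (s.row d (.inr .U) (s.nat (.inr .k) 0)) D (s.row d (.inl .w) 0)) :
    Run (addSemispace d) s (D.card * (d * 40 + 60) + (d * 150 + 150)) fun s' =>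
      s'.nat (.inr .nC) 0 = s.nat (.inr .nC) 0 + 1 ∧
      (∀ r ≠ s.nat (.inr .nC) 0, ∀ m, s'.real (.inr .C) r m = s.real (.inr .C) r m) ∧
      (∀ y ∈ D, s'.row d (.inr .C) (s.nat (.inr .nC) 0) ⬝ᵥ y +
        s'.real (.inr .C) (s.nat (.inr .nC) 0) d ≤ 0) ∧
      0 < s'.row d (.inr .C) (s.nat (.inr .nC) 0) ⬝ᵥ s.row d (.inr .U) (s.nat (.inr .k) 0) +
        s'.real (.inr .C) (s.nat (.inr .nC) 0) d := by
  obtain ⟨hcard, hrow⟩ := hs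
  rw [addSemispace_eq]
  refine (Run.seq (run_assignCell (Run.seq ((run_loadHyperplane d _).imp le_rfl fun s₁ hF₁ h₁ =>
    Run.seq ((run_maxLoop d s₁ _ fun _ => rfl).imp (N' := D.card * (d * 40 + 60) + 10) ?_
      fun s₂ hF₂ h₂ => Run.seq (run_assignCell
        (Run.seq (M := 30) ((run_evalPi d _ (by simp) (by simp)).imp le_rfl
          fun s₃ hF₃ h₃ => ?_)))))))).mono ?_
  · have := hF₁.nat (.inr .nD) (by simp [loadHyperplane])
    simp [this, hcard]
  · have hC₂ := hF₂.real (.inr .C) (by simp [maxLoop, evalPi])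
    have hC₃ := hF₃.real (.inr .C) (by simp [evalPi])
    have hnC₁ := congrFun (hF₁.nat (.inr .nC) (by simp [loadHyperplane])) 0
    have hnC₂ := congrFun (hF₂.nat (.inr .nC) (by simp [maxLoop, evalPi])) 0
    have hnC₃ := congrFun (hF₃.nat (.inr .nC) (by simp [evalPi])) 0
    have hnD₁ := congrFun (hF₁.nat (.inr .nD) (by simp [loadHyperplane])) 0
    have hk₁ := congrFun (hF₁.nat (.inr .k) (by simp [loadHyperplane])) 0
    have hk₂ := congrFun (hF₂.nat (.inr .k) (by simp [maxLoop, evalPi])) 0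
    have hU₁ := row_congr (hF₁.real (.inr .U) (by simp [loadHyperplane])) d
    have hU₂ := row_congr (hF₂.real (.inr .U) (by simp [maxLoop, evalPi])) d
    have hD₁ := row_congr (hF₁.real (.inr .D) (by simp [loadHyperplane])) d
    simp at hC₂ hC₃ hnC₁ hnC₂ hnC₃ hnD₁ hk₁ hk₂ hU₁ hU₂ hD₁ h₁ h₃
    obtain ⟨h₁w, h₁x, h₁r⟩ := h₁
    simp only [hnC₁, hnD₁, hcard, hD₁, h₁w, h₁x] at h₂
    obtain ⟨⟨l, hl, hM⟩, hmax⟩ := And.imp_left (fun h => h hD.card_pos) h₂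
    simp only [hnC₁, hnC₂, hk₁, hk₂, hU₁, hU₂, row_congr hC₂, h₁w, h₁x, hC₂] at h₃
    set x := s.row d (.inr .U) (s.nat (.inr .k) 0) with hx
    set w := s.row d (.inl .w) 0 with hw'
    set n := s.nat (.inr .nC) 0 with hn
    set M := s₂.real (.inr .max) 0 0 with hM'
    -- The maximum is attained on `D`, where `π` is negative, so the shift is by a negative amount.
    have hM0 : M < 0 := by
      have := hw _ ((hrow _).2 ⟨l, hl, rfl⟩)
      rw [dotProduct_sub] at this
      linarith
    have hrow₃ : s₃.row d (.inr .C) n = w := by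
      rw [← h₁w, row_eq_iff]
      intro m hm
      simp [hC₃, hC₂, hm.ne]
    have hγ : s₃.real (.inr .C) n d = -(w ⬝ᵥ x) - M / 2 := by
      simp [hC₃, hC₂, hnC₁, hnC₂, h₁x]
    -- The value at `x` is `-M / 2 > 0`, so the branch that reverses the orientation is not taken.
    refine (Run.seq (Run.ite (M := 0) (fun hb => Run.skip (run_assign ?_))
      fun hb => absurd ?_ hb)).mono ?_
    · simp only [State.setNat_row, State.setNat_real, hrow₃, hγ]
      refine ⟨by simp [hnC₃, hnC₂, hnC₁], fun r hr m => ?_, fun y hy => ?_, by linarith⟩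
      · simp [hC₃, hC₂, hnC₂, hnC₁, hr, h₁r]
      · obtain ⟨l, hl, rfl⟩ := (hrow y).1 hy
        have := hmax l hl
        linarith
    · simp [h₃]
      linarith
    · simp
  · simp
    linarith

/-! ### Separation by a convex area and feasibility of the linear programs -/

/-- A convex area that separates `D` from `x` has a semi-space that contains `D` but not `x`, whose
normal vector is feasible for `LP(x, D)`. -/
theorem Separable.exists_lpFeasible {d : ℕ} {DS D : Finset (Fin d → ℝ)} (h : Separable DS D)
    {x : Fin d → ℝ} (hx : x ∈ DS) (hxD : x ∉ D) : ∃ w, LPFeasible x D w := by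
  obtain ⟨C, ⟨K, α, γ, rfl⟩, hD, hdisj⟩ := h
  have hxC : x ∉ ⋂ k, {z | α k ⬝ᵥ z + γ k ≤ 0} := fun hxC =>
    Set.eq_empty_iff_forall_notMem.1 hdisj x ⟨hxC, by simpa using hx, by simpa using hxD⟩
  obtain ⟨k, hk⟩ : ∃ k, 0 < α k ⬝ᵥ x + γ k := by simpa using hxC
  refine ⟨α k, fun y hy => ?_⟩
  have hy' : α k ⬝ᵥ y + γ k ≤ 0 := Set.mem_iInter.1 (hD hy) k
  rw [dotProduct_sub]
  linarith

/-! ### The main loop of `cac` -/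

/-- The main loop of `cac`. -/
def mainLoop (d : ℕ) (gslp : Cmd GVar GTab) : Cmd Var Tab :=
  .loop (.and (.natLt (var .k) (var .nU)) (.natLt (.lit 0) (var .ok))) (
    callGslp d gslp ;;
    .ite (.natLt (.lit 0) (.get (.inl .found) (.lit 0)))
      (addSemispace d ;; assign .k (.add (var .k) (.lit 1)))
      (assign .ok (.lit 0)))

/-- Row `i` of `C` holds a semi-space that contains `D` but not `x`. -/
def CutsOff {d : ℕ} (s : State Var Tab) (D : Finset (Fin d → ℝ)) (x : Fin d → ℝ) (i : ℕ) : Prop :=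
  (∀ y ∈ D, s.row d (.inr .C) i ⬝ᵥ y + s.real (.inr .C) i d ≤ 0) ∧
    0 < s.row d (.inr .C) i ⬝ᵥ x + s.real (.inr .C) i d

theorem CutsOff.congr {d : ℕ} {s s' : State Var Tab} {D : Finset (Fin d → ℝ)} {x : Fin d → ℝ}
    {i : ℕ} (h : CutsOff s D x i) (hC : ∀ m, s'.real (.inr .C) i m = s.real (.inr .C) i m) :
    CutsOff s' D x i := by
  have hr : s'.row d (.inr .C) i = s.row d (.inr .C) i := funext fun m => hC m
  rwa [CutsOff, hr, hC]

/-- Either the loop has cut off every point of `U`, or it has met a point for which the linear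
program is infeasible. -/
theorem run_mainLoop {d c : ℕ} {gslp : Cmd GVar GTab} (hg : SolvesLPInLinearTime d c gslp)
    {DS D : Finset (Fin d → ℝ)} (hD : D.Nonempty) (s : State Var Tab)
    (hs : s.Stores (.inr .nD) (.inr .D) D) (hok : s.nat (.inr .ok) 0 = 1)
    (hnC : s.nat (.inr .nC) 0 = 0) (hk : s.nat (.inr .k) 0 = 0)
    (hU : ∀ i < s.nat (.inr .nU) 0, s.row d (.inr .U) i ∈ DS ∧ s.row d (.inr .U) i ∉ D) :
    Run (mainLoop d gslp) s
      (s.nat (.inr .nU) 0 * (D.card * (d * 65 + c + 90) + (d * 175 + 250)) + 20) fun s' =>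
      (s'.nat (.inr .ok) 0 = 0 ∧ ¬ Separable DS D) ∨
      (s'.nat (.inr .ok) 0 = 1 ∧ s'.nat (.inr .nC) 0 = s.nat (.inr .nU) 0 ∧
        ∀ i < s.nat (.inr .nU) 0, CutsOff s' D (s.row d (.inr .U) i) i) := by
  -- As long as `ok` is set, `r` is the number of points of `U` still to be treated; once it is
  -- cleared, the loop ends whatever `r` is.
  refine (Run.loop (N := D.card * (d * 65 + c + 90) + (d * 175 + 230))
    (fun r s' => Frame (mainLoop d gslp) s s' ∧
      ((s'.nat (.inr .ok) 0 = 0 ∧ ¬ Separable DS D) ∨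
        (s'.nat (.inr .ok) 0 = 1 ∧ s'.nat (.inr .k) 0 + r = s.nat (.inr .nU) 0 ∧
          s'.nat (.inr .nC) 0 = s'.nat (.inr .k) 0 ∧
          ∀ i < s'.nat (.inr .k) 0, CutsOff s' D (s.row d (.inr .U) i) i)))
    ?_ (s.nat (.inr .nU) 0) s ⟨.refl _ _, .inr ⟨hok, by omega, by omega, by simp [hk]⟩⟩).imp ?_ ?_
  · rintro r s₁ ⟨hF₁, hI⟩ ⟨hlt, hok₁⟩
    have hwU : ¬ (mainLoop d gslp).WritesNat (.inr .nU) := by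
      simp [mainLoop, callGslp, addSemispace, evalPi]
    have hwnD : ¬ (mainLoop d gslp).WritesNat (.inr .nD) := by
      simp [mainLoop, callGslp, addSemispace, evalPi]
    have hwU' : ¬ (mainLoop d gslp).WritesReal (.inr .U) := by
      simp [mainLoop, callGslp, addSemispace, evalPi]
    have hwD : ¬ (mainLoop d gslp).WritesReal (.inr .D) := by
      simp [mainLoop, callGslp, addSemispace, evalPi]
    simp only [Cond.eval, eval_var, NExpr.eval, hF₁.nat _ hwU] at hlt hok₁
    obtain ⟨hok₀, -⟩ | ⟨hok₁, hr, hnC₁, hcut⟩ := hI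
    · omega
    obtain ⟨r, rfl⟩ : ∃ r', r = r' + 1 := ⟨r - 1, by omega⟩
    refine ⟨r, rfl, ?_⟩
    have hst (s' : State Var Tab) (hn : s'.nat (.inr .nD) = s.nat (.inr .nD))
        (ht : s'.real (.inr .D) = s.real (.inr .D)) : s'.Stores (.inr .nD) (.inr .D) D := by
      simpa only [State.Stores, hn, row_congr ht] using hs
    set x := s.row d (.inr .U) (s₁.nat (.inr .k) 0) with hx
    have hx₁ : s₁.row d (.inr .U) (s₁.nat (.inr .k) 0) = x := row_congr (hF₁.real _ hwU') d _
    have key : Run _ s₁ (D.card * (d * 65 + c + 90) + (d * 175 + 230)) _ :=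
      (Run.seq ((run_callGslp hg hD s₁ (hst s₁ (hF₁.nat _ hwnD) (hF₁.real _ hwD))
        (hx₁ ▸ (hU _ hlt).2)).imp le_rfl fun s₂ hF₂ h₂ => Run.ite
          (q := assign .ok (.lit 0)) (b := .natLt (.lit 0) (.get (.inl .found) (.lit 0)))
          (Q := fun s' => (s'.nat (.inr .ok) 0 = 0 ∧ ¬ Separable DS D) ∨
            (s'.nat (.inr .ok) 0 = 1 ∧ s'.nat (.inr .k) 0 + r = s.nat (.inr .nU) 0 ∧
              s'.nat (.inr .nC) 0 = s'.nat (.inr .k) 0 ∧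
              ∀ i < s'.nat (.inr .k) 0, CutsOff s' D (s.row d (.inr .U) i) i))
          (fun hb => Run.seq (q := assign .k (.add (var .k) (.lit 1)))
            ((run_addSemispace hD s₂ (hst s₂ ?_ ?_) ?_).imp le_rfl
              fun s₃ hF₃ h₃ => run_assign (.inr ?_)))
          fun hb => run_assign (.inl ?_))).mono ?_
    · refine key.imp le_rfl fun s' hF h => ⟨hF₁.trans ?_, h⟩
      exact ⟨hF.nat, hF.real⟩
    all_goals try
      have hk₂ := congrFun (hF₂.nat (.inr .k) (by simp [callGslp])) 0
      have hnC₂ := congrFun (hF₂.nat (.inr .nC) (by simp [callGslp])) 0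
      have hU₂ := row_congr (hF₂.real (.inr .U) (by simp [callGslp])) d
    · rw [hF₂.nat _ (by simp [callGslp]), hF₁.nat _ hwnD]
    · rw [hF₂.real _ (by simp [callGslp]), hF₁.real _ hwD]
    · rw [hU₂, hk₂]
      exact h₂.2 (Nat.pos_iff_ne_zero.1 hb)
    · obtain ⟨h₃n, h₃r, h₃D, h₃x⟩ := h₃
      have hk₃ := congrFun (hF₃.nat (.inr .k) (by simp [addSemispace, evalPi])) 0
      have hok₃ := congrFun (hF₃.nat (.inr .ok) (by simp [addSemispace, evalPi])) 0
      have hok₂ := congrFun (hF₂.nat (.inr .ok) (by simp [callGslp])) 0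
      rw [hU₂, hk₂, hx₁, hnC₂, hnC₁] at h₃x
      rw [hnC₂, hnC₁] at h₃D h₃n h₃r
      refine ⟨by simp [hok₃, hok₂, hok₁], by simp [hk₃, hk₂]; omega, by simp [h₃n, hk₃, hk₂],
        fun i hi => ?_⟩
      have hi' : i < s₁.nat (.inr .k) 0 + 1 := by simpa [hk₃, hk₂] using hi
      obtain hi' | rfl := Nat.lt_succ_iff_lt_or_eq.1 hi'
      · refine (hcut i hi').congr fun m => ?_
        rw [State.setNat_real, h₃r i hi'.ne, hF₂.real (.inr .C) (by simp [callGslp])]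
      · exact ⟨h₃D, h₃x⟩
    · refine ⟨by simp, fun hsep => h₂.1 (Nat.eq_zero_of_not_pos hb) ?_⟩
      rw [hx₁]
      exact hsep.exists_lpFeasible (hU _ hlt).1 (hU _ hlt).2
    · simp
      linarith
  · simp
    exact Nat.le_add_right_of_le (Nat.mul_le_mul_left _ (by omega))
  · rintro s' - ⟨hb, r, hF, h | ⟨hok', hr, hnC', hcut⟩⟩
    · exact .inl h
    · have hnU := congrFun (hF.nat (.inr .nU)
        (by simp [mainLoop, callGslp, addSemispace, evalPi])) 0
      have : s'.nat (.inr .k) 0 = s.nat (.inr .nU) 0 := by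
        simp [hok', hnU] at hb
        omega
      rw [this] at hcut hnC'
      exact .inr ⟨hok', hnC', hcut⟩

theorem cac_eq (d : ℕ) (gslp : Cmd GVar GTab) : cac d gslp =
    (buildU d ;;
    assign .ok (.lit 1) ;;
    assign .nC (.lit 0) ;;
    assign .k (.lit 0) ;;
    mainLoop d gslp) := rfl

/-- `cac` reports that `D` is not separable or else its stored semi-spaces contain `D`, and every
point of `DS` outside `D` is cut off by one of them. -/
theorem run_cac {d c : ℕ} {gslp : Cmd GVar GTab} (hg : SolvesLPInLinearTime d c gslp)
    {DS D : Finset (Fin d → ℝ)} (hsub : D ⊆ DS) (hD : D.Nonempty) (s : State Var Tab)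
    (hs : HoldsInput s DS D) :
    Run (cac d gslp) s ((d * 400 + c + 1000) * (DS.card * D.card)) fun s' =>
      (s'.nat (.inr .ok) 0 = 0 ∧ ¬ Separable DS D) ∨
      (s'.nat (.inr .ok) 0 = 1 ∧
        (∀ i < s'.nat (.inr .nC) 0, ∀ y ∈ D,
          s'.row d (.inr .C) i ⬝ᵥ y + s'.real (.inr .C) i d ≤ 0) ∧
        ∀ x ∈ DS, x ∉ D → ∃ i < s'.nat (.inr .nC) 0,
          0 < s'.row d (.inr .C) i ⬝ᵥ x + s'.real (.inr .C) i d) := by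
  obtain ⟨⟨hDS, hDSrow⟩, hDc, hDrow⟩ := hs
  rw [cac_eq]
  refine (Run.seq ((run_buildU d s).imp le_rfl fun s₁ hF₁ h₁ => Run.seq
    (M := 3 + (3 + (DS.card * (D.card * (d * 65 + c + 90) + (d * 175 + 250)) + 20)))
    (run_assign (Run.seq (run_assign (Run.seq (run_assign
      ((run_mainLoop (DS := DS) hg hD _ ?_ (by simp) (by simp) (by simp) ?_).imp ?_
        fun s' hF h => ?_)))))))).mono ?_
  all_goals try
    have hU_iff : ∀ z, (∃ i < s₁.nat (.inr .nU) 0, s₁.row d (.inr .U) i = z) ↔ z ∈ DS ∧ z ∉ D := by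
      simpa only [hDS, hDc, ← hDSrow, ← hDrow] using h₁.2
    have hU_le : s₁.nat (.inr .nU) 0 ≤ DS.card := hDS ▸ h₁.1
  · have hnD : s₁.nat (.inr .nD) 0 = s.nat (.inr .nD) 0 := by rw [hF₁.nat _ (by simp [buildU])]
    have hD₁ := row_congr (hF₁.real (.inr .D) (by simp [buildU])) d
    exact ⟨by simpa [hnD] using hDc, by simpa [hD₁] using hDrow⟩
  · intro i hi
    exact (hU_iff _).1 ⟨i, by simpa using hi, rfl⟩
  · simp
    gcongr
  · simp only [ne_eq, reduceCtorEq, not_false_eq_true, State.setNat_nat_of_ne, Sum.inr.injEq,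
      State.setNat_row] at h
    refine h.imp_right fun ⟨hok, hnC, hcut⟩ => ⟨hok, ?_, fun x hx hxD => ?_⟩
    · rw [hnC]
      exact fun i hi => (hcut i hi).1
    · obtain ⟨i, hi, rfl⟩ := (hU_iff x).2 ⟨hx, hxD⟩
      exact ⟨i, hnC ▸ hi, (hcut i hi).2⟩
  · have hp : 1 ≤ D.card := hD.card_pos
    have hn : 1 ≤ DS.card := (hD.mono hsub).card_pos
    have hnp : 1 ≤ DS.card * D.card := Nat.mul_pos hn hp
    have h₁ : DS.card * 1 ≤ DS.card * D.card := Nat.mul_le_mul_left _ hp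
    have h₂ := Nat.mul_le_mul_left d h₁
    -- `n' ≥ 1` absorbs the terms `n` and `d n`, and `n n' ≥ 1` the constants.
    rw [hDS, hDc]
    simp only [NExpr.cost]
    nlinarith

end ConvexArea

theorem lemma2 (d c : ℕ) :
    ∃ K : ℕ, ∀ gslp : RealRAM.Cmd ConvexArea.GVar ConvexArea.GTab,
      ConvexArea.SolvesLPInLinearTime d c gslp →
      ∀ DS D : Finset (Fin d → ℝ), D ⊆ DS → D.Nonempty →
      ∀ s : RealRAM.State ConvexArea.Var ConvexArea.Tab, ConvexArea.HoldsInput s DS D →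
      ∃ (t : ℕ) (s' : RealRAM.State ConvexArea.Var ConvexArea.Tab),
        RealRAM.Exec (ConvexArea.cac d gslp) s t s' ∧
        (ConvexArea.output d s' = ∅ → ¬ ConvexArea.Separable DS D) ∧
        (∀ C : Set (Fin d → ℝ), ConvexArea.output d s' = C → C ≠ ∅ →
          ConvexArea.IsConvexArea C ∧ ConvexArea.Separates C DS D) ∧
        t ≤ K * (DS.card * D.card) := by
  refine ⟨d * 400 + c + 1000, fun gslp hg DS D hsub hD s hs => ?_⟩
  obtain ⟨t, s', he, ht, h⟩ := ConvexArea.run_cac hg hsub hD s hs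
  refine ⟨t, s', he, ?_, ?_, ht⟩
  · obtain ⟨-, h⟩ | ⟨hok, hin, -⟩ := h
    · exact fun _ => h
    · intro hout
      obtain ⟨y, hy⟩ := hD
      have : y ∈ ConvexArea.output d s' := by
        simp only [ConvexArea.output, hok, one_ne_zero, if_false, Set.mem_iInter]
        exact fun k => hin k k.2 y hy
      simp [hout] at this
  · rintro C rfl hne
    obtain ⟨hok, -⟩ | ⟨hok, hin, hcut⟩ := h
    · simp [ConvexArea.output, hok] at hne
    · have hout : ConvexArea.output d s' = ⋂ k : Fin (s'.nat (.inr .nC) 0),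
          {z | s'.row d (.inr .C) k ⬝ᵥ z + s'.real (.inr .C) k d ≤ 0} := by
        simp [ConvexArea.output, hok]
      rw [hout]
      refine ⟨⟨_, _, _, rfl⟩, fun y hy => Set.mem_iInter.2 fun k => hin k k.2 y hy, ?_⟩
      refine Set.eq_empty_iff_forall_notMem.2 ?_
      rintro x ⟨hxC, hx, hxD⟩
      obtain ⟨i, hi, h⟩ := hcut x hx hxD
      have : s'.row d (.inr .C) i ⬝ᵥ x + s'.real (.inr .C) i d ≤ 0 :=
        Set.mem_iInter.1 hxC ⟨i, hi⟩
      linarith
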